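/- Let $\mathbf k$ be an algebraically closed field, let $k$ be a natural number and let $F_k$ be the free group on $x_1,\dots,x_k$. The character of a representation $\rho:F_k\to \mathrm{SL}_2(\mathbf k)$ is the function $\chi_\rho:F_k\to\mathbf k$, $\chi_\rho(g)=\operatorname{tr}\rho(g)$. The character variety $\mathfrak X_k=\mathfrak X(F_k,\mathrm{SL}_2)\subset \mathbf k^{F_k}$ is the set of all these characters. For $g\in F_k$ let $t_g:\mathfrak X_k\to\mathbf k$ be the function $\chi\mapsto\chi(g)$; the coordinate ring $\mathcal O_{\mathfrak X_k}$ is the $\mathbf k$-algebra of functions on $\mathfrak X_k$ generated by all $t_g$, $g\in F_k$. With $A_i=\rho(x_i)$, write $t_{A_{i_1}\cdots A_{i_p}}$ for $t_{x_{i_1}\cdots x_{i_p}}$. Then: (1) If $\operatorname{char}\mathbf k\neq 2$, the $\mathbf k$-algebra $\mathcal O_{\mathfrak X_k}$ is generated by the traces $t_{A_i}$, $t_{A_iA_j}$ ($i<j$) and $t_{A_iA_jA_l}$ ($i<j<l$), $1\le i,j,l\le k$. (2) If $k\ge 2$ (in any characteristic), the $3k-3$ traces $$t_{A_1},\ t_{A_2},\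 t_{A_1A_2},\qquad t_{A_j},\ t_{A_1A_j},\ t_{A_2A_j}\quad (3\le j\le k)$$ form a transcendence basis of $\mathcal O_{\mathfrak X_k}$ over $\mathbf k$. -/

import Mathlib

namespace SLCharacterVariety

/-- The character `χ_ρ : Γ → K`, `g ↦ tr ρ(g)`, of a representation `ρ : Γ → SL_r(K)`. -/
def character {Γ : Type*} [Group Γ] {r : ℕ} {K : Type*} [Field K]
    (ρ : Γ →* Matrix.SpecialLinearGroup (Fin r) K) : Γ → K :=
  fun g => Matrix.trace (ρ g : Matrix (Fin r) (Fin r) K)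

/-- The character variety `X(Γ, SL_r)`: the image of the character map
`Hom(Γ, SL_r(K)) → K^Γ`, `ρ ↦ χ_ρ`. -/
def characterVariety (Γ : Type*) [Group Γ] (r : ℕ) (K : Type*) [Field K] : Set (Γ → K) :=
  Set.range (character : (Γ →* Matrix.SpecialLinearGroup (Fin r) K) → Γ → K)

/-- The function on `X(Γ, SL_r)` that sends a character `χ_ρ` to its value `tr ρ(g)`. -/
def traceFun {Γ : Type*} [Group Γ] (r : ℕ) (K : Type*) [Field K] (g : Γ) :
    characterVariety Γ r K → K :=
  fun χ => χ.1 g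

/-- The coordinate ring of `X(Γ, SL_r)`: the functions on `X(Γ, SL_r) ⊆ K^Γ` that are
polynomials in the coordinates of `K^Γ`, that is, in the trace functions. -/
def coordinateRing (Γ : Type*) [Group Γ] (r : ℕ) (K : Type*) [Field K] :
    Subalgebra K (characterVariety Γ r K → K) :=
  Algebra.adjoin K (Set.range (traceFun r K))

/-- The trace function of `g ∈ Γ` as an element `t_g` of the coordinate ring. -/
def t {Γ : Type*} [Group Γ] (r : ℕ) (K : Type*) [Field K] (g : Γ) : coordinateRing Γ r K :=
  ⟨traceFun r K g, Algebra.subset_adjoin ⟨g, rfl⟩⟩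

/-- Index set of the list `t_{A_1}, t_{A_2}, t_{A_1A_2}` (first summand) followed by
`t_{A_j}, t_{A_1A_j}, t_{A_2A_j}` for `j ≥ 3` (second summand). The generators of `F_k` are
numbered from `0`, so `j ≥ 3` reads `2 ≤ j`. -/
abbrev BasisIndex (k : ℕ) : Type :=
  Fin 3 ⊕ {j : Fin k // 2 ≤ (j : ℕ)} × Fin 3

/-- The elements `x_1, x_2, x_1x_2` and `x_j, x_1x_j, x_2x_j`, `j ≥ 3`, of `F_k`. -/
def basisWord {k : ℕ} (hk : 2 ≤ k) : BasisIndex k → FreeGroup (Fin k) :=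
  let x : Fin k → FreeGroup (Fin k) := FreeGroup.of
  let x₁ := x ⟨0, by omega⟩
  let x₂ := x ⟨1, by omega⟩
  Sum.elim ![x₁, x₂, x₁ * x₂] fun p => ![x p.1, x₁ * x p.1, x₂ * x p.1] p.2

/-- The elements `x_i`, `x_ix_j` and `x_ix_jx_l`, `i < j < l`, of `F_k`. -/
def shortWords (k : ℕ) : Set (FreeGroup (Fin k)) :=
  {g | (∃ i, g = FreeGroup.of i) ∨
    (∃ i j, i < j ∧ g = FreeGroup.of i * FreeGroup.of j) ∨
    (∃ i j l, i < j ∧ j < l ∧ g = FreeGroup.of i * FreeGroup.of j * FreeGroup.of l)}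

end SLCharacterVariety

/-! Generation: `t_inv_mul` removes inverse letters, and `two_mul_trace_mul_four` writes twice the
trace of a product of four factors through traces of products of at most three. Taking the last
factor to be a whole tail, induction on length leaves words with at most three letters, which
Cayley–Hamilton sorts.

Transcendence basis: where `commDisc` is nonzero, `1, a, b, ab` is a basis of the two by two
matrices, and `gram_mul_trace_mul` recovers `tr(mc)` from the pairings of `m` and `c` with it, with
denominator `commDisc`. So the elements whose four pairings are algebraic over the proposed basis
form a subgroup. It contains each generator because `tr(x₁x₂x_j)` satisfies the monic quadratic
`trace_mul_three_sq`. Independence holds because every tuple of values off a proper hypersurface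
comes from a representation (`exists_pair_extending_traces`). -/

/-! ### Trace identities for two by two matrices -/

namespace Matrix

variable {R : Type*} [CommRing R]

theorem trace_mul_three_add_swap (a b c : Matrix (Fin 2) (Fin 2) R) :
    trace (a * b * c) + trace (a * c * b) =
      trace a * trace (b * c) + trace b * trace (a * c) + trace c * trace (a * b) -
        trace a * trace b * trace c := by
  simp only [trace_fin_two, mul_apply, Fin.sum_univ_two]
  ring

/-- Twice the trace of a product of four matrices, in terms of traces of shorter products. -/
theorem two_mul_trace_mul_four (a b c d : Matrix (Fin 2) (Fin 2) R) :
    2 * trace (a * b * c * d) =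
      trace a * trace b * trace c * trace d + trace a * trace (b * c * d) +
        trace b * trace (a * c * d) + trace c * trace (a * b * d) + trace d * trace (a * b * c) -
        trace a * trace b * trace (c * d) - trace b * trace c * trace (a * d) -
        trace a * trace d * trace (b * c) - trace c * trace d * trace (a * b) +
        trace (a * b) * trace (c * d) - trace (a * c) * trace (b * d) +
        trace (a * d) * trace (b * c) := by
  simp only [trace_fin_two, mul_apply, Fin.sum_univ_two]
  ring

/-- The roots are `tr(abc)` and `tr(acb)`: their sum is given by `trace_mul_three_add_swap`, and the
constant term is their product. -/
theorem trace_mul_three_sq (a b c : Matrix (Fin 2) (Fin 2) R) :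
    trace (a * b * c) ^ 2 -
        (trace a * trace (b * c) + trace b * trace (a * c) + trace c * trace (a * b) -
          trace a * trace b * trace c) * trace (a * b * c) +
      (trace a ^ 2 * det b * det c + trace b ^ 2 * det a * det c + trace c ^ 2 * det a * det b +
        trace (a * b) ^ 2 * det c + trace (a * c) ^ 2 * det b + trace (b * c) ^ 2 * det a -
        trace a * trace b * trace (a * b) * det c - trace a * trace c * trace (a * c) * det b -
        trace b * trace c * trace (b * c) * det a +
        trace (a * b) * trace (a * c) * trace (b * c) - 4 * det a * det b * det c) = 0 := by
  simp only [trace_fin_two, det_fin_two, mul_apply, Fin.sum_univ_two]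
  ring

/-- The trace pairing of two matrices in terms of their pairings with `1, a, b, ab`. -/
theorem gram_mul_trace_mul (a b m c : Matrix (Fin 2) (Fin 2) R) :
    (trace a ^ 2 * det b + trace b ^ 2 * det a + trace (a * b) ^ 2 -
        trace a * trace b * trace (a * b) - 4 * det a * det b) * trace (m * c) =
      (trace a ^ 2 * det b + trace b ^ 2 * det a + trace (a * b) ^ 2 -
        trace a * trace b * trace (a * b) - 2 * det a * det b) * (trace m * trace c) -
      trace a * det b * (trace m * trace (c * a) + trace (m * a) * trace c) -
      trace b * det a * (trace m * trace (c * b) + trace (m * b) * trace c) +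
      (trace a * trace b - trace (a * b)) *
        (trace m * trace (c * a * b) + trace (m * a * b) * trace c) +
      2 * det b * (trace (m * a) * trace (c * a)) +
      trace (a * b) * (trace (m * a) * trace (c * b) + trace (m * b) * trace (c * a)) -
      trace b * (trace (m * a) * trace (c * a * b) + trace (m * a * b) * trace (c * a)) +
      2 * det a * (trace (m * b) * trace (c * b)) -
      trace a * (trace (m * b) * trace (c * a * b) + trace (m * a * b) * trace (c * b)) +
      2 * (trace (m * a * b) * trace (c * a * b)) := by
  simp only [trace_fin_two, det_fin_two, mul_apply, Fin.sum_univ_two]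
  ring

/-- Polarized Cayley–Hamilton, which expresses `ab + ba` through `1, a, b`. -/
theorem trace_mul_mul_swap (m a b : Matrix (Fin 2) (Fin 2) R) :
    trace (m * b * a) = trace a * trace (m * b) + trace b * trace (m * a) +
      (trace (a * b) - trace a * trace b) * trace m - trace (m * a * b) := by
  simp only [trace_fin_two, mul_apply, Fin.sum_univ_two]
  ring

theorem trace_mul_mul_self (m a : Matrix (Fin 2) (Fin 2) R) :
    trace (m * a * a) = trace a * trace (m * a) - det a * trace m := by
  simp only [trace_fin_two, det_fin_two, mul_apply, Fin.sum_univ_two]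
  ring

/-- Cayley–Hamilton for `ab` with one `a` cancelled: `bab = tr(ab) b - det(b) adj(a)`. -/
theorem trace_mul_sandwich (m a b : Matrix (Fin 2) (Fin 2) R) :
    trace (m * b * a * b) =
      trace (a * b) * trace (m * b) + det b * (trace (m * a) - trace a * trace m) := by
  simp only [trace_fin_two, det_fin_two, mul_apply, Fin.sum_univ_two]
  ring

theorem trace_adjugate_mul (a b : Matrix (Fin 2) (Fin 2) R) :
    trace (adjugate a * b) = trace a * trace b - trace (a * b) := by
  simp only [adjugate_fin_two, trace_fin_two, mul_apply, Fin.sum_univ_two, of_apply, cons_val_zero,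
    cons_val_one]
  ring

end Matrix

/-! ### Relations between trace functions -/

namespace SLCharacterVariety

section Eval

variable {Γ : Type*} [Group Γ] {r : ℕ} {K : Type*} [Field K]

/-- Evaluation of regular functions at the character of `ρ`. -/
def evalAt (ρ : Γ →* Matrix.SpecialLinearGroup (Fin r) K) : coordinateRing Γ r K →ₐ[K] K :=
  (Pi.evalAlgHom K (fun _ => K) ⟨character ρ, ρ, rfl⟩).comp (coordinateRing Γ r K).val

@[simp]
theorem evalAt_t (ρ : Γ →* Matrix.SpecialLinearGroup (Fin r) K) (g : Γ) :
    evalAt ρ (t r K g) = Matrix.trace (ρ g : Matrix (Fin r) (Fin r) K) :=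
  rfl

theorem coordinateRing_ext {f g : coordinateRing Γ r K}
    (h : ∀ ρ : Γ →* Matrix.SpecialLinearGroup (Fin r) K, evalAt ρ f = evalAt ρ g) : f = g := by
  apply Subtype.ext
  funext ⟨χ, ρ, hρ⟩
  subst hρ
  exact h ρ

theorem adjoin_range_t : Algebra.adjoin K (Set.range (t (Γ := Γ) r K)) = ⊤ := by
  refine Eq.trans (congrArg _ ?_)
    (Algebra.adjoin_adjoin_coe_preimage (s := Set.range (traceFun (Γ := Γ) r K)))
  ext f
  simp only [Set.mem_range]
  exact ⟨fun ⟨g, hg⟩ => ⟨g, congrArg Subtype.val hg⟩, fun ⟨g, hg⟩ => ⟨g, Subtype.ext hg⟩⟩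

end Eval

section Relations

variable {Γ : Type*} [Group Γ] {K : Type*} [Field K]

local notation "τ" => t 2 K

theorem t_one : τ (1 : Γ) = 2 := by
  refine coordinateRing_ext fun ρ => ?_
  simp [map_ofNat]

theorem t_mul_comm (g h : Γ) : τ (g * h) = τ (h * g) := by
  refine coordinateRing_ext fun ρ => ?_
  simp [Matrix.trace_mul_comm (ρ g : Matrix (Fin 2) (Fin 2) K)]

theorem t_inv_mul (g h : Γ) : τ (g⁻¹ * h) = τ g * τ h - τ (g * h) := by
  refine coordinateRing_ext fun ρ => ?_
  simpa using Matrix.trace_adjugate_mul (ρ g : Matrix (Fin 2) (Fin 2) K) (ρ h)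

theorem t_inv (g : Γ) : τ g⁻¹ = τ g := by
  have := t_inv_mul (K := K) g 1
  rw [mul_one, mul_one, t_one] at this
  rw [this]; ring

theorem t_mul_three_add_swap (a b c : Γ) :
    τ (a * b * c) + τ (a * c * b) =
      τ a * τ (b * c) + τ b * τ (a * c) + τ c * τ (a * b) - τ a * τ b * τ c := by
  refine coordinateRing_ext fun ρ => ?_
  simpa using Matrix.trace_mul_three_add_swap (ρ a : Matrix (Fin 2) (Fin 2) K) (ρ b) (ρ c)

theorem two_mul_t_mul_four (a b c d : Γ) :
    2 * τ (a * b * c * d) =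
      τ a * τ b * τ c * τ d + τ a * τ (b * c * d) +
        τ b * τ (a * c * d) + τ c * τ (a * b * d) + τ d * τ (a * b * c) -
        τ a * τ b * τ (c * d) - τ b * τ c * τ (a * d) -
        τ a * τ d * τ (b * c) - τ c * τ d * τ (a * b) +
        τ (a * b) * τ (c * d) - τ (a * c) * τ (b * d) + τ (a * d) * τ (b * c) := by
  refine coordinateRing_ext fun ρ => ?_
  simpa [map_ofNat] using
    Matrix.two_mul_trace_mul_four (ρ a : Matrix (Fin 2) (Fin 2) K) (ρ b) (ρ c) (ρ d)

theorem t_mul_three_sq (a b c : Γ) :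
    τ (a * b * c) ^ 2 -
        (τ a * τ (b * c) + τ b * τ (a * c) + τ c * τ (a * b) - τ a * τ b * τ c) * τ (a * b * c) +
      (τ a ^ 2 + τ b ^ 2 + τ c ^ 2 + τ (a * b) ^ 2 + τ (a * c) ^ 2 + τ (b * c) ^ 2 -
        τ a * τ b * τ (a * b) - τ a * τ c * τ (a * c) - τ b * τ c * τ (b * c) +
        τ (a * b) * τ (a * c) * τ (b * c) - 4) = 0 := by
  refine coordinateRing_ext fun ρ => ?_
  simpa [map_ofNat] using Matrix.trace_mul_three_sq (ρ a : Matrix (Fin 2) (Fin 2) K) (ρ b) (ρ c)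

theorem t_mul_mul_swap (m a b : Γ) :
    τ (m * b * a) = τ a * τ (m * b) + τ b * τ (m * a) +
      (τ (a * b) - τ a * τ b) * τ m - τ (m * a * b) := by
  refine coordinateRing_ext fun ρ => ?_
  simpa using Matrix.trace_mul_mul_swap (ρ m : Matrix (Fin 2) (Fin 2) K) (ρ a) (ρ b)

theorem t_mul_mul_self (m a : Γ) : τ (m * a * a) = τ a * τ (m * a) - τ m := by
  refine coordinateRing_ext fun ρ => ?_
  simpa using Matrix.trace_mul_mul_self (ρ m : Matrix (Fin 2) (Fin 2) K) (ρ a)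

theorem t_mul_sandwich (m a b : Γ) :
    τ (m * b * a * b) = τ (a * b) * τ (m * b) + (τ (m * a) - τ a * τ m) := by
  refine coordinateRing_ext fun ρ => ?_
  simpa using Matrix.trace_mul_sandwich (ρ m : Matrix (Fin 2) (Fin 2) K) (ρ a) (ρ b)

variable (K) in
/-- The function `tr(aba⁻¹b⁻¹) - 2`, which vanishes at `ρ` when `ρ(a), ρ(b)` have a common
eigenvector. -/
def commDisc (a b : Γ) : coordinateRing Γ 2 K :=
  τ a ^ 2 + τ b ^ 2 + τ (a * b) ^ 2 - τ a * τ b * τ (a * b) - 4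

theorem commDisc_mul_t_mul (a b m c : Γ) :
    commDisc K a b * τ (m * c) =
      (commDisc K a b + 2) * (τ m * τ c) -
      τ a * (τ m * τ (c * a) + τ (m * a) * τ c) -
      τ b * (τ m * τ (c * b) + τ (m * b) * τ c) +
      (τ a * τ b - τ (a * b)) * (τ m * τ (c * a * b) + τ (m * a * b) * τ c) +
      2 * (τ (m * a) * τ (c * a)) +
      τ (a * b) * (τ (m * a) * τ (c * b) + τ (m * b) * τ (c * a)) -
      τ b * (τ (m * a) * τ (c * a * b) + τ (m * a * b) * τ (c * a)) +
      2 * (τ (m * b) * τ (c * b)) -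
      τ a * (τ (m * b) * τ (c * a * b) + τ (m * a * b) * τ (c * b)) +
      2 * (τ (m * a * b) * τ (c * a * b)) := by
  refine coordinateRing_ext fun ρ => ?_
  have := Matrix.gram_mul_trace_mul (ρ a : Matrix (Fin 2) (Fin 2) K) (ρ b) (ρ m) (ρ c)
  simp only [Matrix.SpecialLinearGroup.det_coe, mul_one] at this
  simp only [commDisc, map_add, map_sub, map_mul, map_pow, map_ofNat, evalAt_t,
    Matrix.SpecialLinearGroup.coe_mul]
  linear_combination this

end Relations

/-! ### Generation by words of length at most three -/

section ShortWords

variable {K : Type*} [Field K] {ι : Type*} [LinearOrder ι]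

local notation "τ" => t 2 K

theorem t_of_mul_of_mem {L : Subalgebra K (coordinateRing (FreeGroup ι) 2 K)}
    (h₁ : ∀ i : ι, τ (FreeGroup.of i) ∈ L)
    (h₂ : ∀ i j : ι, i < j → τ (FreeGroup.of i * FreeGroup.of j) ∈ L) (i j : ι) :
    τ (FreeGroup.of i * FreeGroup.of j) ∈ L := by
  rcases lt_trichotomy i j with h | rfl | h
  · exact h₂ i j h
  · have := t_mul_mul_self (K := K) 1 (FreeGroup.of i)
    rw [one_mul, t_one] at this
    rw [this]
    exact sub_mem (mul_mem (h₁ i) (h₁ i)) (ofNat_mem L 2)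
  · rw [t_mul_comm]
    exact h₂ j i h

theorem t_of_mul_of_mul_of_mem {L : Subalgebra K (coordinateRing (FreeGroup ι) 2 K)}
    (h₁ : ∀ i : ι, τ (FreeGroup.of i) ∈ L)
    (h₂ : ∀ i j : ι, i < j → τ (FreeGroup.of i * FreeGroup.of j) ∈ L)
    (h₃ : ∀ i j l : ι, i < j → j < l →
      τ (FreeGroup.of i * FreeGroup.of j * FreeGroup.of l) ∈ L) (i j l : ι) :
    τ (FreeGroup.of i * FreeGroup.of j * FreeGroup.of l) ∈ L := by
  have h₂' := t_of_mul_of_mem h₁ h₂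
  -- Rotations and one transposition give all orders of three letters; `rep` covers repeated
  -- letters.
  have rot : ∀ i j l : ι, τ (FreeGroup.of i * FreeGroup.of j * FreeGroup.of l) ∈ L →
      τ (FreeGroup.of j * FreeGroup.of l * FreeGroup.of i) ∈ L := fun i j l h => by
    rwa [mul_assoc, t_mul_comm] at h
  have swap : ∀ i j l : ι, τ (FreeGroup.of i * FreeGroup.of j * FreeGroup.of l) ∈ L →
      τ (FreeGroup.of i * FreeGroup.of l * FreeGroup.of j) ∈ L := fun i j l h => by
    rw [eq_sub_of_add_eq' (t_mul_three_add_swap (K := K) _ _ _)]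
    exact sub_mem (sub_mem (add_mem (add_mem (mul_mem (h₁ i) (h₂' j l)) (mul_mem (h₁ j) (h₂' i l)))
      (mul_mem (h₁ l) (h₂' i j))) (mul_mem (mul_mem (h₁ i) (h₁ j)) (h₁ l))) h
  have rep : ∀ i j : ι, τ (FreeGroup.of i * FreeGroup.of j * FreeGroup.of j) ∈ L := fun i j => by
    rw [t_mul_mul_self]
    exact sub_mem (mul_mem (h₁ j) (h₂' i j)) (h₁ i)
  rcases lt_trichotomy j l with hjl | rfl | hjl
  · rcases lt_trichotomy i j with hij | rfl | hij
    · exact h₃ i j l hij hjl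
    · exact rot _ _ _ (rep l i)
    · rcases lt_trichotomy i l with hil | rfl | hil
      · exact swap _ _ _ (rot _ _ _ (h₃ j i l hij hil))
      · exact rot _ _ _ (rot _ _ _ (rep j i))
      · exact rot _ _ _ (rot _ _ _ (h₃ j l i hjl hil))
  · exact rep i j
  · rcases lt_trichotomy i l with hil | rfl | hil
    · exact swap _ _ _ (h₃ i l j hil hjl)
    · exact rot _ _ _ (rot _ _ _ (rep j i))
    · rcases lt_trichotomy i j with hij | rfl | hij
      · exact rot _ _ _ (h₃ l i j hil hij)
      · exact rot _ _ _ (rep l i)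
      · exact rot _ _ _ (swap _ _ _ (h₃ l j i hjl hij))

theorem t_prod_of_mem (h2 : (2 : K) ≠ 0) {L : Subalgebra K (coordinateRing (FreeGroup ι) 2 K)}
    (h₁ : ∀ i : ι, τ (FreeGroup.of i) ∈ L)
    (h₂ : ∀ i j : ι, i < j → τ (FreeGroup.of i * FreeGroup.of j) ∈ L)
    (h₃ : ∀ i j l : ι, i < j → j < l →
      τ (FreeGroup.of i * FreeGroup.of j * FreeGroup.of l) ∈ L) (w : List ι) :
    τ (w.map FreeGroup.of).prod ∈ L := by
  induction hn : w.length using Nat.strong_induction_on generalizing w with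
  | _ n ih =>
  subst hn
  have ih' : ∀ w' : List ι, w'.length < w.length → τ (w'.map FreeGroup.of).prod ∈ L :=
    fun w' h => ih _ h w' rfl
  match w, ih' with
  | [], _ => simp [t_one]
  | [i], _ => simpa using h₁ i
  | [i, j], _ => simpa using t_of_mul_of_mem h₁ h₂ i j
  | [i, j, l], _ => simpa [mul_assoc] using t_of_mul_of_mul_of_mem h₁ h₂ h₃ i j l
  | a :: b :: c :: d :: w, ih =>
    -- The fourth factor is the entire tail, so every other word in the identity is strictly
    -- shorter.
    set D := ((d :: w).map (FreeGroup.of (α := ι))).prod with hD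
    have key := two_mul_t_mul_four (K := K) (FreeGroup.of a) (FreeGroup.of b) (FreeGroup.of c) D
    have hd : τ D ∈ L := ih (d :: w) (by simp)
    have had : ∀ i, τ (FreeGroup.of i * D) ∈ L := fun i => by
      simpa [hD] using ih (i :: d :: w) (by simp)
    have habd : ∀ i j, τ (FreeGroup.of i * FreeGroup.of j * D) ∈ L := fun i j => by
      simpa [hD, mul_assoc] using ih (i :: j :: d :: w) (by simp)
    have h2' := t_of_mul_of_mem h₁ h₂
    have hmem : 2 * τ (FreeGroup.of a * FreeGroup.of b * FreeGroup.of c * D) ∈ L := by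
      rw [key]
      refine add_mem (sub_mem (add_mem (sub_mem (sub_mem (sub_mem (sub_mem (add_mem (add_mem
        (add_mem (add_mem ?_ ?_) ?_) ?_) ?_) ?_) ?_) ?_) ?_) ?_) ?_) ?_
      all_goals
        repeat' apply mul_mem
        all_goals first
          | exact h₁ _ | exact hd | exact had _ | exact habd _ _ | exact h2' _ _
          | exact t_of_mul_of_mul_of_mem h₁ h₂ h₃ _ _ _
    have h := L.smul_mem hmem (2⁻¹ : K)
    have e : (2 : coordinateRing (FreeGroup ι) 2 K) = algebraMap K _ 2 := (map_ofNat _ 2).symm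
    rw [e, ← Algebra.smul_def, smul_smul, inv_mul_cancel₀ h2, one_smul] at h
    simpa [hD, mul_assoc] using h

/-- Trace functions of short positive words generate all trace functions. -/
theorem t_mem_of_shortWords (h2 : (2 : K) ≠ 0)
    {L : Subalgebra K (coordinateRing (FreeGroup ι) 2 K)}
    (h₁ : ∀ i : ι, τ (FreeGroup.of i) ∈ L)
    (h₂ : ∀ i j : ι, i < j → τ (FreeGroup.of i * FreeGroup.of j) ∈ L)
    (h₃ : ∀ i j l : ι, i < j → j < l →
      τ (FreeGroup.of i * FreeGroup.of j * FreeGroup.of l) ∈ L) (g : FreeGroup ι) :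
    τ g ∈ L := by
  -- The positive tail `w` absorbs the letters peeled off the right end of `g`.
  suffices H : ∀ w : List ι, τ (g * (w.map FreeGroup.of).prod) ∈ L by simpa using H []
  have hg : g ∈ Subgroup.closure (Set.range (FreeGroup.of (α := ι))) := by
    rw [FreeGroup.closure_range_of]; trivial
  induction hg using Subgroup.closure_induction_right with
  | one => simpa using t_prod_of_mem h2 h₁ h₂ h₃
  | mul_right x _ y hy ih =>
    obtain ⟨i, rfl⟩ := hy
    intro w
    simpa [mul_assoc] using ih (i :: w)
  | mul_inv_cancel x _ y hy ih =>
    obtain ⟨i, rfl⟩ := hy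
    intro w
    rw [mul_assoc, t_mul_comm, mul_assoc, t_inv_mul, t_mul_comm _ x, ← mul_assoc, t_mul_comm _ x]
    exact sub_mem (mul_mem (h₁ i) (ih w)) (by simpa [mul_assoc] using ih (i :: w))

end ShortWords

theorem adjoin_t_shortWords {K : Type*} [Field K] (h2 : (2 : K) ≠ 0) (k : ℕ) :
    Algebra.adjoin K (t 2 K '' shortWords k) = ⊤ := by
  rw [eq_top_iff, ← adjoin_range_t, Algebra.adjoin_le_iff]
  rintro _ ⟨g, rfl⟩
  refine t_mem_of_shortWords h2 (fun i => ?_) (fun i j hij => ?_) (fun i j l hij hjl => ?_) g <;>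
    refine Algebra.subset_adjoin ⟨_, ?_, rfl⟩
  · exact .inl ⟨i, rfl⟩
  · exact .inr (.inl ⟨i, j, hij, rfl⟩)
  · exact .inr (.inr ⟨i, j, l, hij, hjl, rfl⟩)

/-! ### Algebraic dependence on the basis -/

section Pairing

variable {Γ : Type*} [Group Γ] {K : Type*} [Field K]

local notation "τ" => t 2 K

theorem commDisc_mem {L : Subalgebra K (coordinateRing Γ 2 K)} {a b : Γ}
    (ha : τ a ∈ L) (hb : τ b ∈ L) (hab : τ (a * b) ∈ L) : commDisc K a b ∈ L :=
  sub_mem (sub_mem (add_mem (add_mem (pow_mem ha 2) (pow_mem hb 2)) (pow_mem hab 2))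
    (mul_mem (mul_mem ha hb) hab)) (ofNat_mem L 4)

/-- The pairings of `ga` with `1, a, b, ab` are those of `g` with `a, a², ab, a²b`, and
Cayley–Hamilton reduces `a²`. -/
theorem t_pairing_mul_left_mem {L : Subalgebra K (coordinateRing Γ 2 K)} {a b g : Γ}
    (ha : τ a ∈ L) (hg : τ g ∈ L ∧ τ (g * a) ∈ L ∧ τ (g * b) ∈ L ∧ τ (g * a * b) ∈ L) :
    τ (g * a) ∈ L ∧ τ (g * a * a) ∈ L ∧ τ (g * a * b) ∈ L ∧ τ (g * a * a * b) ∈ L := by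
  obtain ⟨h, h₁, h₂, h₃⟩ := hg
  refine ⟨h₁, ?_, h₃, ?_⟩
  · rw [t_mul_mul_self]
    exact sub_mem (mul_mem ha h₁) h
  · rw [t_mul_comm, ← mul_assoc, ← mul_assoc, t_mul_mul_self, t_mul_comm b g, mul_assoc b,
      t_mul_comm b]
    exact sub_mem (mul_mem ha h₃) h₂

theorem t_pairing_mul_right_mem {L : Subalgebra K (coordinateRing Γ 2 K)} {a b g : Γ}
    (ha : τ a ∈ L) (hb : τ b ∈ L) (hab : τ (a * b) ∈ L)
    (hg : τ g ∈ L ∧ τ (g * a) ∈ L ∧ τ (g * b) ∈ L ∧ τ (g * a * b) ∈ L) :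
    τ (g * b) ∈ L ∧ τ (g * b * a) ∈ L ∧ τ (g * b * b) ∈ L ∧ τ (g * b * a * b) ∈ L := by
  obtain ⟨h, h₁, h₂, h₃⟩ := hg
  have hba : τ (g * b * a) ∈ L := by
    rw [t_mul_mul_swap]
    exact sub_mem (add_mem (add_mem (mul_mem ha h₂) (mul_mem hb h₁))
      (mul_mem (sub_mem hab (mul_mem ha hb)) h)) h₃
  have hbb : τ (g * b * b) ∈ L := by
    rw [t_mul_mul_self]
    exact sub_mem (mul_mem hb h₂) h
  refine ⟨h₂, hba, hbb, ?_⟩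
  rw [t_mul_sandwich]
  exact add_mem (mul_mem hab h₂) (sub_mem h₁ (mul_mem ha h))

variable (K) in
/-- If `L` is saturated with respect to `commDisc K a b`, the elements whose trace pairings with
`1, a, b, ab` belong to `L` form a subgroup. -/
def pairingSubgroup (L : Subalgebra K (coordinateRing Γ 2 K)) (a b : Γ) (ha : τ a ∈ L)
    (hb : τ b ∈ L) (hab : τ (a * b) ∈ L) (hL : ∀ f, commDisc K a b * f ∈ L → f ∈ L) :
    Subgroup Γ where
  carrier := {g | τ g ∈ L ∧ τ (g * a) ∈ L ∧ τ (g * b) ∈ L ∧ τ (g * a * b) ∈ L}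
  one_mem' := by
    simp [t_one, ha, hb, hab]
  inv_mem' := by
    rintro g ⟨h, h₁, h₂, h₃⟩
    refine ⟨by rwa [t_inv], ?_, ?_, ?_⟩
    · rw [t_inv_mul]
      exact sub_mem (mul_mem h ha) h₁
    · rw [t_inv_mul]
      exact sub_mem (mul_mem h hb) h₂
    · rw [mul_assoc, t_inv_mul, ← mul_assoc]
      exact sub_mem (mul_mem h hab) h₃
  mul_mem' := by
    have hδ : commDisc K a b ∈ L := commDisc_mem ha hb hab
    have key : ∀ g h : Γ, (τ g ∈ L ∧ τ (g * a) ∈ L ∧ τ (g * b) ∈ L ∧ τ (g * a * b) ∈ L) →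
        (τ h ∈ L ∧ τ (h * a) ∈ L ∧ τ (h * b) ∈ L ∧ τ (h * a * b) ∈ L) → τ (g * h) ∈ L := by
      rintro g h ⟨hg, hg₁, hg₂, hg₃⟩ ⟨hh, hh₁, hh₂, hh₃⟩
      -- `commDisc` times this trace is a polynomial in the known pairings; saturation cancels the
      -- factor.
      apply hL
      rw [commDisc_mul_t_mul]
      have h2 : (2 : coordinateRing Γ 2 K) ∈ L := ofNat_mem L 2
      repeat' first | assumption | apply add_mem | apply sub_mem | apply mul_mem
    intro g h hg hh
    have hha := t_pairing_mul_left_mem ha hh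
    have hhb := t_pairing_mul_right_mem ha hb hab hh
    refine ⟨key g h hg hh, ?_, ?_, ?_⟩
    · rw [mul_assoc]
      exact key _ _ hg hha
    · rw [mul_assoc]
      exact key _ _ hg hhb
    · rw [mul_assoc, mul_assoc, ← mul_assoc h]
      exact key _ _ hg (t_pairing_mul_right_mem ha hb hab hha)

end Pairing

/-! ### Elements algebraic over a subalgebra -/

section AlgebraicClosure

variable {K R : Type*} [Field K] [CommRing R] [Algebra K R] (S : Subalgebra K R)

theorem isIntegral_of_sq_sub_mul_add_eq_zero {p q x : R} (hp : p ∈ S) (hq : q ∈ S)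
    (h : x ^ 2 - p * x + q = 0) : IsIntegral S x := by
  refine ⟨.X ^ 2 + (.C (-⟨p, hp⟩) * .X + .C ⟨q, hq⟩), ?_, ?_⟩
  · monicity!
  · rw [← Polynomial.aeval_def, ← h]
    simp
    ring

/-- The elements of `R` algebraic over the subalgebra `S`. -/
def algebraicOver [IsDomain S] : Subalgebra K R :=
  (Subalgebra.algebraicClosure S R).restrictScalars K

variable {S}

theorem mem_algebraicOver [IsDomain S] {x : R} : x ∈ algebraicOver S ↔ IsAlgebraic S x :=
  Iff.rfl

theorem le_algebraicOver [IsDomain S] : S ≤ algebraicOver S := fun x hx =>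
  isAlgebraic_algebraMap (A := R) (⟨x, hx⟩ : S)

theorem mem_algebraicOver_of_mul_mem [IsDomain S] {d x : R} (hd : d ∈ S) (hd0 : d ≠ 0)
    (h : d * x ∈ algebraicOver S) : x ∈ algebraicOver S :=
  IsAlgebraic.of_smul (y := (⟨d, hd⟩ : S))
    (mem_nonZeroDivisors_of_ne_zero fun h => hd0 (congrArg Subtype.val h)) h

/-- `R` need not be a domain: the subalgebra generated by `x` is one, being isomorphic to a
polynomial ring. -/
theorem isTranscendenceBasis_of_forall_isAlgebraic {ι : Type*} {x : ι → R}
    (ind : AlgebraicIndependent K x)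
    (h : ∀ S : Subalgebra K R, IsDomain S → (∀ i, x i ∈ S) → Algebra.IsAlgebraic S R) :
    IsTranscendenceBasis K x :=
  ind.isTranscendenceBasis_iff_isAlgebraic.mpr <|
    h _ (ind.aevalEquiv.symm.toMulEquiv.isDomain _) fun i => Algebra.subset_adjoin ⟨i, rfl⟩

end AlgebraicClosure

section Algebraic

variable {K : Type*} [Field K]

local notation "τ" => t 2 K

theorem isIntegral_t_mul_three {Γ : Type*} [Group Γ] (S : Subalgebra K (coordinateRing Γ 2 K))
    {a b c : Γ} (ha : τ a ∈ S) (hb : τ b ∈ S) (hc : τ c ∈ S) (hab : τ (a * b) ∈ S)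
    (hac : τ (a * c) ∈ S) (hbc : τ (b * c) ∈ S) : IsIntegral S (τ (a * b * c)) := by
  have h4 : (4 : coordinateRing Γ 2 K) ∈ S := ofNat_mem S 4
  refine isIntegral_of_sq_sub_mul_add_eq_zero S ?_ ?_ (t_mul_three_sq a b c) <;>
    repeat' first | assumption | apply add_mem | apply sub_mem | apply mul_mem | apply pow_mem

theorem isAlgebraic_of_basisWord_mem {k : ℕ} (hk : 2 ≤ k)
    (S : Subalgebra K (coordinateRing (FreeGroup (Fin k)) 2 K)) [IsDomain S]
    (mem : ∀ i, τ (basisWord hk i) ∈ S)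
    (hδ : commDisc K (FreeGroup.of (⟨0, by omega⟩ : Fin k))
      (FreeGroup.of (⟨1, by omega⟩ : Fin k)) ≠ 0) :
    Algebra.IsAlgebraic S (coordinateRing (FreeGroup (Fin k)) 2 K) := by
  set x₁ := FreeGroup.of (⟨0, by omega⟩ : Fin k)
  set x₂ := FreeGroup.of (⟨1, by omega⟩ : Fin k)
  have h₁ : τ x₁ ∈ S := mem (.inl 0)
  have h₂ : τ x₂ ∈ S := mem (.inl 1)
  have h₁₂ : τ (x₁ * x₂) ∈ S := mem (.inl 2)
  have hδS : commDisc K x₁ x₂ ∈ S := commDisc_mem h₁ h₂ h₁₂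
  set L := algebraicOver S
  have hSL : ∀ {f}, f ∈ S → f ∈ L := fun hf => le_algebraicOver hf
  have hL : ∀ f, commDisc K x₁ x₂ * f ∈ L → f ∈ L := fun f hf =>
    mem_algebraicOver_of_mul_mem hδS hδ hf
  have htop : pairingSubgroup K L x₁ x₂ (hSL h₁) (hSL h₂) (hSL h₁₂) hL = ⊤ := by
    have h1 := (pairingSubgroup K L x₁ x₂ (hSL h₁) (hSL h₂) (hSL h₁₂) hL).one_mem
    rw [eq_top_iff, ← FreeGroup.closure_range_of, Subgroup.closure_le]
    rintro _ ⟨j, rfl⟩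
    by_cases hj : 2 ≤ (j : ℕ)
    · have hj₀ : τ (FreeGroup.of j) ∈ S := mem (.inr (⟨j, hj⟩, 0))
      have hj₁ : τ (x₁ * FreeGroup.of j) ∈ S := mem (.inr (⟨j, hj⟩, 1))
      have hj₂ : τ (x₂ * FreeGroup.of j) ∈ S := mem (.inr (⟨j, hj⟩, 2))
      refine ⟨hSL hj₀, ?_, ?_, ?_⟩
      · rw [t_mul_comm]
        exact hSL hj₁
      · rw [t_mul_comm]
        exact hSL hj₂
      · rw [mul_assoc, t_mul_comm]
        exact mem_algebraicOver.mpr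
          (isIntegral_t_mul_three S h₁ h₂ hj₀ h₁₂ hj₁ hj₂).isAlgebraic
    -- The first two generators are reached by multiplying the identity, whose pairings are known.
    · have hx : FreeGroup.of j = 1 * x₁ ∨ FreeGroup.of j = 1 * x₂ := by
        simp only [one_mul, x₁, x₂, FreeGroup.of_injective.eq_iff, Fin.ext_iff]
        omega
      rcases hx with hx | hx <;> rw [hx]
      · exact t_pairing_mul_left_mem (hSL h₁) h1
      · exact t_pairing_mul_right_mem (hSL h₁) (hSL h₂) (hSL h₁₂) h1
  have hLtop : L = ⊤ := by
    rw [eq_top_iff, ← adjoin_range_t, Algebra.adjoin_le_iff]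
    rintro _ ⟨g, rfl⟩
    have : g ∈ pairingSubgroup K L x₁ x₂ (hSL h₁) (hSL h₂) (hSL h₁₂) hL := htop ▸ trivial
    exact this.1
  exact ⟨fun f => mem_algebraicOver.mp (hLtop ▸ trivial : f ∈ L)⟩

end Algebraic

/-! ### Representations with prescribed traces -/

section Prescribed

open Matrix

variable {K : Type*} [Field K] [IsAlgClosed K]

theorem exists_quadratic_root {a : K} (b c : K) (ha : a ≠ 0) : ∃ u, a * u ^ 2 + b * u + c = 0 := by
  obtain ⟨u, hu⟩ := IsAlgClosed.exists_root (.C a * .X ^ 2 + .C b * .X + .C c : Polynomial K)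
    (by rw [Polynomial.degree_quadratic ha]; decide)
  exact ⟨u, by simpa [Polynomial.IsRoot] using hu⟩

theorem exists_pair_extending_traces (x y z : K) (hz : z ^ 2 - 4 ≠ 0)
    (hδ : x ^ 2 + y ^ 2 + z ^ 2 - x * y * z - 4 ≠ 0) :
    ∃ A B : SpecialLinearGroup (Fin 2) K, trace A.1 = x ∧ trace B.1 = y ∧ trace (A.1 * B.1) = z ∧
      ∀ p q r : K, ∃ C : SpecialLinearGroup (Fin 2) K,
        trace C.1 = p ∧ trace (A.1 * C.1) = q ∧ trace (B.1 * C.1) = r := by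
  -- `w` and `s = w⁻¹` will be the eigenvalues of `AB`, which is upper triangular for the matrices
  -- below; `z² ≠ 4` makes them distinct.
  obtain ⟨w, hw⟩ := exists_quadratic_root (-z) 1 (one_ne_zero (α := K))
  have hw0 : w ≠ 0 := by rintro rfl; simp at hw
  have hzw : z = w + w⁻¹ := by field_simp; linear_combination -hw
  set s := w⁻¹ with hs
  have hws : w * s = 1 := mul_inv_cancel₀ hw0
  subst hzw
  have hd : w - s ≠ 0 := fun h => hz (by linear_combination (w - s) * h + 4 * hws)
  refine ⟨⟨!![x, -1; 1, 0], by simp [det_fin_two]⟩, ⟨!![0, w; -s, y], by simp [det_fin_two, hws]⟩,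
    by simp [trace_fin_two], by simp [trace_fin_two],
    by simp [trace_fin_two, add_comm], fun p q r => ?_⟩
  set d := (w - s)⁻¹ with hdd
  have hdi : (w - s) * d = 1 := mul_inv_cancel₀ hd
  -- the entry `C 1 0` is `m * u + n` in terms of `u = C 0 0`
  set m := (y - x * s) * d with hm
  set n := (r - y * p + q * s) * d with hn
  have hmw : (w - s) * m = y - x * s := by rw [hm]; linear_combination (y - x * s) * hdi
  -- The trace conditions leave `u` free and `det C = 1` is a quadratic in `u`. Its leading
  -- coefficient is minus the quantity in `hδ` divided by `(w - s)² = z² - 4`.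
  have hlead : -1 - (m - x) * m ≠ 0 := fun h => hδ (by
    linear_combination -(w - s) ^ 2 * h + (4 - x ^ 2) * hws -
      ((w - s) * m + (y - x * s) - x * (w - s)) * hmw)
  obtain ⟨u, hu⟩ := exists_quadratic_root (p - (m - x) * n - (q + n) * m) (-((q + n) * n) - 1) hlead
  refine ⟨⟨!![u, q - x * u + (m * u + n); m * u + n, p - u], ?_⟩, ?_, ?_, ?_⟩
  · rw [det_fin_two_of]
    linear_combination hu
  · simp [trace_fin_two]
  · simp [trace_fin_two]
    ring
  · simp [trace_fin_two]
    rw [hm, hn]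
    linear_combination (u * (y - x * s) + r - y * p + q * s) * hdi

theorem exists_representation_trace_basisWord {k : ℕ} (hk : 2 ≤ k) (v : BasisIndex k → K)
    (hz : v (.inl 2) ^ 2 - 4 ≠ 0)
    (hδ : v (.inl 0) ^ 2 + v (.inl 1) ^ 2 + v (.inl 2) ^ 2 -
      v (.inl 0) * v (.inl 1) * v (.inl 2) - 4 ≠ 0) :
    ∃ ρ : FreeGroup (Fin k) →* SpecialLinearGroup (Fin 2) K,
      ∀ i, trace (ρ (basisWord hk i)).1 = v i := by
  obtain ⟨A, B, hA, hB, hAB, H⟩ := exists_pair_extending_traces _ _ _ hz hδ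
  choose C hC using fun j : {j : Fin k // 2 ≤ (j : ℕ)} =>
    H (v (.inr (j, 0))) (v (.inr (j, 1))) (v (.inr (j, 2)))
  let ρ : FreeGroup (Fin k) →* SpecialLinearGroup (Fin 2) K := FreeGroup.lift fun j =>
    if h : 2 ≤ (j : ℕ) then C ⟨j, h⟩ else if (j : ℕ) = 0 then A else B
  have h₀ : ρ (FreeGroup.of ⟨0, by omega⟩) = A := by simp [ρ]
  have h₁ : ρ (FreeGroup.of ⟨1, by omega⟩) = B := by simp [ρ]
  have hj (j : {j : Fin k // 2 ≤ (j : ℕ)}) : ρ (FreeGroup.of j.1) = C j := by simp [ρ, j.2]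
  refine ⟨ρ, ?_⟩
  rintro (i | ⟨j, i⟩)
  · fin_cases i
    · simpa [basisWord, h₀] using hA
    · simpa [basisWord, h₁] using hB
    · simpa [basisWord, h₀, h₁] using hAB
  · fin_cases i
    · simpa [basisWord, hj] using (hC j).1
    · simpa [basisWord, h₀, hj] using (hC j).2.1
    · simpa [basisWord, h₁, hj] using (hC j).2.2

end Prescribed

/-! ### Algebraic independence -/

section Independent

open MvPolynomial

theorem exists_sq_sub_four_ne_zero (K : Type*) [Field K] : ∃ z : K, z ^ 2 - 4 ≠ 0 := by
  by_contra! h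
  have h₀ := h 0
  have h₁ := h 1
  -- The values `-4` and `-3` differ by one, so they cannot both vanish in any characteristic.
  exact one_ne_zero (α := K) (by linear_combination h₁ - h₀)

variable {K : Type*} [Field K] [IsAlgClosed K]

theorem algebraicIndependent_t_basisWord {k : ℕ} (hk : 2 ≤ k) :
    AlgebraicIndependent K fun i => t 2 K (basisWord hk i) := by
  rw [algebraicIndependent_iff]
  intro P hP
  let Z : MvPolynomial (BasisIndex k) K := X (.inl 2) ^ 2 - C 4
  let D : MvPolynomial (BasisIndex k) K := X (.inl 0) ^ 2 + X (.inl 1) ^ 2 + X (.inl 2) ^ 2 -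
    X (.inl 0) * X (.inl 1) * X (.inl 2) - C 4
  obtain ⟨z, hz⟩ := exists_sq_sub_four_ne_zero K
  have hZD : Z * D ≠ 0 := by
    intro h
    have := congrArg (eval fun i => if i = Sum.inl 2 then z else 0) h
    simp [Z, D, hz] at this
  -- Off `Z * D = 0` every point is realized by a representation, where `P` vanishes; a polynomial
  -- vanishing everywhere on an infinite field is zero.
  have hPZD : P * (Z * D) = 0 := by
    refine MvPolynomial.funext fun v => ?_
    rw [map_zero, map_mul, map_mul, mul_eq_zero, mul_eq_zero]
    by_contra! hv
    obtain ⟨hPv, hZv, hDv⟩ := hv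
    simp only [Z, D, map_sub, map_add, map_mul, map_pow, eval_X, eval_C] at hZv hDv
    obtain ⟨ρ, hρ⟩ := exists_representation_trace_basisWord hk v hZv hDv
    apply hPv
    have := congrArg (evalAt ρ) hP
    rw [map_zero, ← AlgHom.comp_apply, comp_aeval] at this
    simpa [Function.comp_def, hρ, aeval_eq_eval] using this
  exact (mul_eq_zero.mp hPZD).resolve_right hZD

theorem commDisc_ne_zero {k : ℕ} (hk : 2 ≤ k) :
    commDisc K (FreeGroup.of (⟨0, by omega⟩ : Fin k)) (FreeGroup.of (⟨1, by omega⟩ : Fin k)) ≠ 0 := by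
  obtain ⟨z, hz⟩ := exists_sq_sub_four_ne_zero K
  obtain ⟨ρ, hρ⟩ := exists_representation_trace_basisWord hk
    (fun i => if i = Sum.inl 2 then z else 0) (by simpa using hz) (by simpa using hz)
  have h₀ : evalAt ρ (t 2 K (FreeGroup.of (⟨0, by omega⟩ : Fin k))) = 0 := by
    simpa using! hρ (.inl 0)
  have h₁ : evalAt ρ (t 2 K (FreeGroup.of (⟨1, by omega⟩ : Fin k))) = 0 := by
    simpa using! hρ (.inl 1)
  have h₂ : evalAt ρ (t 2 K (FreeGroup.of (⟨0, by omega⟩ : Fin k) *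
      FreeGroup.of (⟨1, by omega⟩ : Fin k))) = z := by
    simpa [-evalAt_t] using! hρ (.inl 2)
  intro h
  have := congrArg (evalAt ρ) h
  simp only [commDisc, map_sub, map_add, map_mul, map_pow, map_ofNat, h₀, h₁, h₂, map_zero] at this
  exact hz (by linear_combination this)

end Independent

theorem natCard_basisIndex {k : ℕ} (hk : 2 ≤ k) : Nat.card (BasisIndex k) = 3 * k - 3 := by
  have h : Fintype.card {j : Fin k // 2 ≤ (j : ℕ)} = k - 2 := by
    rw [← Fintype.card_fin (k - 2)]
    exact Fintype.card_congr
      { toFun := fun j => ⟨j.1 - 2, by omega⟩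
        invFun := fun i => ⟨⟨i + 2, by omega⟩, by simp⟩
        left_inv := fun j => by ext; simp; omega
        right_inv := fun i => by ext; simp }
  simp only [BasisIndex, Nat.card_eq_fintype_card, Fintype.card_sum, Fintype.card_prod, h,
    Fintype.card_fin]
  omega

end SLCharacterVariety

theorem corollaryc (K : Type*) [Field K] [IsAlgClosed K] (k : ℕ) :
    ((2 : K) ≠ 0 →
      Algebra.adjoin K (SLCharacterVariety.t 2 K '' SLCharacterVariety.shortWords k) =
        (⊤ : Subalgebra K (SLCharacterVariety.coordinateRing (FreeGroup (Fin k)) 2 K))) ∧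
    ∀ hk : 2 ≤ k,
      Nat.card (SLCharacterVariety.BasisIndex k) = 3 * k - 3 ∧
      IsTranscendenceBasis K fun i : SLCharacterVariety.BasisIndex k =>
        SLCharacterVariety.t 2 K (SLCharacterVariety.basisWord hk i) :=
  open SLCharacterVariety in
  ⟨fun h2 => adjoin_t_shortWords h2 k, fun hk => ⟨natCard_basisIndex hk,
    isTranscendenceBasis_of_forall_isAlgebraic (algebraicIndependent_t_basisWord hk)
      fun S _ mem => isAlgebraic_of_basisWord_mem hk S mem (commDisc_ne_zero hk)⟩⟩
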